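/- Let $(\Omega,\mathcal F,\mathbb P)$ be a probability space, let $0<D<\infty$, $\mathcal D=(0,D)^2$ and $0<K<\infty$. A process $l=(l(t))_{t\in[0,D]}$ of real random variables is a *Lévy subordinator on $[0,D]$* if $l(0)=0$ a.s., $l$ has independent and stationary increments, $l$ is stochastically continuous, and its paths are a.s. non-decreasing. Assume: * $\bar a:\mathcal D\to(0,\infty)$ is continuous with $0<\bar a_-\le\bar a\le\bar a_+<\infty$ on $\mathcal D$; * $\Phi_1,\Phi_2:\mathbb R\to[0,\infty)$, $\Phi_1\in C^1(\mathbb R)$, and there are constants $\phi,\psi,C_{lip}>0$ with $|\Phi_1'(x)|\le\phi\, e^{\psi|x|}$ and $|\Phi_2(x)-\Phi_2(y)|\le C_{lip}|x-y|$ for all $x,y\in\mathbb R$; * $W_1$ on $[0,D]^2$ and $W_2$ on $[0,K]^2$ are zero-mean Gaussian random fields with a.s. continuous paths, and $W_1$ and $W_2$ are stochastically independent; * $l_1,l_2$ are Lévy subordinators on $[0,D]$, each of which is independent of $W_1$ and independent of $W_2$. Put $\chi_c(z)=\min(z,c)$ and, for $A>0$, $$a_K(\omega,x,y)=\bar a(x,y)+\Phi_1(W_1(x,y))+\Phi_2\bigl(W_2(\chi_K(l_1(x)),\chi_K(l_2(y)))\bigr),\qquad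 a_{K,A}=\chi_A(a_K),\qquad (x,y)\in\mathcal D .$$ Then $\operatorname{ess\,sup}_{\mathcal D}a_K$ and, for every $A>0$, $\operatorname{ess\,sup}_{\mathcal D}|a_K-a_{K,A}|$ (essential suprema over $\mathcal D$ with respect to Lebesgue measure) are, up to $\mathbb P$-null sets, $[0,\infty]$-valued random variables, and for every real $n\in(1,\infty)$ $$\mathbb E\Bigl(\bigl(\operatorname{ess\,sup}_{\underline x\in\mathcal D}a_K(\underline x)\bigr)^n\Bigr)^{1/n}<+\infty .$$ Moreover, for every $n\in(1,\infty)$ and every $\delta>0$ there is a constant $A=A(\delta,n)>0$ such that $$\mathbb E\Bigl(\bigl(\operatorname{ess\,sup}_{\underline x\in\mathcal D}|a_K(\underline x)-a_{K,A}(\underline x)|\bigr)^n\Bigr)^{1/n}<\delta .$$ -/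

import Mathlib

open MeasureTheory ProbabilityTheory Set Filter Topology
open scoped ENNReal

noncomputable section

/-- The spatial domain `(0, D)²`. -/
def openSquare (D : ℝ) : Set (ℝ × ℝ) := Ioo 0 D ×ˢ Ioo 0 D

/-- The closed square `[0, R]²`. -/
def closedSquare (R : ℝ) : Set (ℝ × ℝ) := Icc 0 R ×ˢ Icc 0 R

/-- The path of the process `X` on the parameter set `S`, as an element of the product space
`S → ℝ` (with its product σ-algebra). Only the values of `X` on `S` matter. -/
def pathOn {T Ω : Type*} (S : Set T) (X : T → Ω → ℝ) (ω : Ω) : S → ℝ := fun s => X s ω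

/-- `W` is a zero-mean Gaussian random field on the parameter set `S` with almost surely
continuous paths. The values of `W` outside `S` are irrelevant. -/
structure IsCenteredContinuousGRF {Ω : Type*} [MeasurableSpace Ω] (S : Set (ℝ × ℝ))
    (W : ℝ × ℝ → Ω → ℝ) (P : Measure Ω) : Prop where
  gaussian : IsGaussianProcess (fun (z : S) => W z) P
  mean_zero : ∀ z ∈ S, ∫ ω, W z ω ∂P = 0
  continuous_paths : ∀ᵐ ω ∂P, ContinuousOn (fun z => W z ω) S

/-- `l` is a real-valued Lévy process on the time interval `[0, T]`: it starts in `0` almost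
surely, has independent and stationary increments, and is stochastically continuous.
The values of `l` outside `[0, T]` are irrelevant. -/
structure IsLevyProcessOn {Ω : Type*} [MeasurableSpace Ω] (T : ℝ) (l : ℝ → Ω → ℝ)
    (P : Measure Ω) : Prop where
  aemeasurable : ∀ t ∈ Icc 0 T, AEMeasurable (l t) P
  start_zero : ∀ᵐ ω ∂P, l 0 ω = 0
  indep_increments : HasIndepIncrements (fun (t : Icc (0 : ℝ) T) => l t) P
  stationary_increments : ∀ s t : ℝ, 0 ≤ s → s ≤ t → t ≤ T →
    IdentDistrib (fun ω => l t ω - l s ω) (fun ω => l (t - s) ω - l 0 ω) P P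
  stochastically_continuous : ∀ t ∈ Icc 0 T, TendstoInMeasure P l (𝓝[Icc 0 T] t) (l t)

/-- A Lévy subordinator on `[0, T]`: a Lévy process that is almost surely non-decreasing. -/
structure IsSubordinatorOn {Ω : Type*} [MeasurableSpace Ω] (T : ℝ) (l : ℝ → Ω → ℝ)
    (P : Measure Ω) : Prop extends IsLevyProcessOn T l P where
  monotone_paths : ∀ᵐ ω ∂P, MonotoneOn (fun t => l t ω) (Icc 0 T)

/-- The cut function `χ_c(z) = min(z, c)`. -/
def cutFun (c z : ℝ) : ℝ := min z c

/-- The coefficient with bounded subordinators,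
`a_K(ω, x, y) = ā(x, y) + Φ₁(W₁(x, y)) + Φ₂(W₂(χ_K(l₁(x)), χ_K(l₂(y))))`. -/
def coeffK {Ω : Type*} (abar : ℝ × ℝ → ℝ) (Φ₁ Φ₂ : ℝ → ℝ) (W₁ W₂ : ℝ × ℝ → Ω → ℝ)
    (l₁ l₂ : ℝ → Ω → ℝ) (K : ℝ) (ω : Ω) (z : ℝ × ℝ) : ℝ :=
  abar z + Φ₁ (W₁ z ω) + Φ₂ (W₂ (cutFun K (l₁ z.1 ω), cutFun K (l₂ z.2 ω)) ω)

/-- The cut-off coefficient `a_{K,A} = χ_A(a_K)`. -/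
def coeffKA {Ω : Type*} (abar : ℝ × ℝ → ℝ) (Φ₁ Φ₂ : ℝ → ℝ) (W₁ W₂ : ℝ × ℝ → Ω → ℝ)
    (l₁ l₂ : ℝ → Ω → ℝ) (K A : ℝ) (ω : Ω) (z : ℝ × ℝ) : ℝ :=
  cutFun A (coeffK abar Φ₁ Φ₂ W₁ W₂ l₁ l₂ K ω z)

/-- The essential supremum over `(0, D)²`, with respect to Lebesgue measure, of a function that is
non-negative there; it takes values in `[0, ∞]`. -/
def spatialEssSup (D : ℝ) (f : ℝ × ℝ → ℝ) : ℝ≥0∞ :=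
  essSup (fun z => ENNReal.ofReal (f z)) (volume.restrict (openSquare D))

end

/-! The subordinators, cut at `K`, only choose where in `[0, K]²` the field `W₂` is evaluated. So,
pathwise, `a_K` is at most `ā₊` plus the suprema of `Φ₁(W₁)` and `Φ₂(W₂)` over compact squares. Both
transformations grow at most exponentially, so all moments of these suprema are finite once the
suprema of `|W₁|` and `|W₂|` have a square-exponential moment. This is Fernique's theorem, obtained
from its finite-dimensional form: the bound there depends only on a level `a` and on a lower bound
`c > 1/2` for the probability of staying below it. It is therefore uniform along a dense sequence of
points, and monotone convergence applies. The truncation error satisfies `|a - min(a, A)| ≤ a² / A`,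
so the moment of order `2n` makes its `n`-th moment `O(A⁻ⁿ)`. For measurability, `a_K` is replaced
by a jointly measurable function equal to it at almost every point, which leaves essential suprema
unchanged. -/

/-! ### Fernique's theorem for bounded Gaussian sequences. -/

/-- The bound in the quantitative Fernique theorem is finite. -/
lemma fernique_bound_lt_top {c : ℝ≥0∞} (hc : 2⁻¹ < c) (hc1 : c < 1) :
    ENNReal.ofReal (Real.exp (Fernique.logRatio c))
      + ∑' n : ℕ, ENNReal.ofReal (Real.exp (-2⁻¹ * Real.log (c / (1 - c)).toReal * 2 ^ n)) < ∞ := by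
  have hc_lt_top : c < ∞ := hc1.trans ENNReal.one_lt_top
  have hc_one_sub_lt_top : 1 - c < ∞ := lt_top_of_lt (b := 2) (tsub_le_self.trans_lt (by simp))
  have h_one_sub_lt_self : 1 - c < c := by
    refine ENNReal.sub_lt_of_lt_add hc1.le ?_
    rw [← two_mul]
    rwa [inv_eq_one_div, ENNReal.div_lt_iff (by simp) (by simp), mul_comm] at hc
  refine ENNReal.add_lt_top.mpr ⟨ENNReal.ofReal_lt_top, ?_⟩
  refine Summable.tsum_ofReal_lt_top <|
    Real.summable_exp_nat_mul_of_ge ?_ (fun i ↦ mod_cast (Nat.lt_pow_self (by simp)).le)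
  refine mul_neg_of_neg_of_pos (by simp) (Real.log_pos ?_)
  simp only [ENNReal.toReal_div, one_lt_div_iff, ENNReal.toReal_pos_iff, tsub_pos_iff_lt, hc1,
    hc_one_sub_lt_top, and_self, true_and]
  rw [ENNReal.toReal_lt_toReal hc_one_sub_lt_top.ne hc_lt_top.ne]
  exact .inl h_one_sub_lt_self

/-- The finite-dimensional laws of a centred Gaussian process are invariant under rotations. -/
lemma ProbabilityTheory.IsGaussianProcess.map_rotation_eq_self {Ω T : Type*} [MeasurableSpace Ω]
    {P : Measure Ω} {X : T → Ω → ℝ} (hX : IsGaussianProcess X P)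
    (h0 : ∀ t, ∫ ω, X t ω ∂P = 0) (I : Finset T) (θ : ℝ) :
    ((P.map fun ω ↦ I.restrict (X · ω)).prod (P.map fun ω ↦ I.restrict (X · ω))).map
      (ContinuousLinearMap.rotation θ) =
      (P.map fun ω ↦ I.restrict (X · ω)).prod (P.map fun ω ↦ I.restrict (X · ω)) := by
  have hG := hX.hasGaussianLaw I
  have := hG.isGaussian_map
  refine IsGaussian.map_rotation_eq_self ?_ θ
  rw [integral_map hG.aemeasurable (by fun_prop)]
  ext i
  simp only [id]
  rw [eval_integral]
  · simpa using h0 i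
  · intro j
    exact (hX.hasGaussianLaw_eval j).integrable

/-- Continuity from below along the levels `k + 1`, whose events exhaust a set of full measure. -/
lemma exists_measure_forall_abs_le {Ω : Type*} [MeasurableSpace Ω]
    {P : Measure Ω} [IsProbabilityMeasure P] {X : ℕ → Ω → ℝ}
    (hb : ∀ᵐ ω ∂P, ∃ b, ∀ n, |X n ω| ≤ b) {c : ℝ≥0∞} (hc : c < 1) :
    ∃ a : ℝ, 0 < a ∧ c ≤ P {ω | ∀ n, |X n ω| ≤ a} := by
  have hmono : Monotone fun k : ℕ ↦ {ω | ∀ n, |X n ω| ≤ k + 1} := by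
    intro k m hkm ω hω n
    have : (k : ℝ) ≤ m := by exact_mod_cast hkm
    linarith [show |X n ω| ≤ k + 1 from hω n, this]
  have hu : P (⋃ k : ℕ, {ω | ∀ n, |X n ω| ≤ k + 1}) = 1 := by
    rw [← measure_univ (μ := P)]
    apply measure_congr
    filter_upwards [hb] with ω ⟨b, hb⟩
    refine propext ⟨fun _ ↦ trivial, fun _ ↦ ?_⟩
    obtain ⟨k, hk⟩ := exists_nat_ge b
    refine mem_iUnion.2 ⟨k, fun n ↦ ?_⟩
    linarith [hb n]
  have ht := tendsto_measure_iUnion_atTop (μ := P) hmono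
  rw [hu] at ht
  obtain ⟨k, hk⟩ := (ht.eventually (lt_mem_nhds hc)).exists
  exact ⟨k + 1, by positivity, hk.le⟩

/-- **Fernique's theorem** for almost surely bounded centred Gaussian sequences. -/
theorem ProbabilityTheory.IsGaussianProcess.exists_lintegral_iSup_exp_sq_lt_top
    {Ω : Type*} [MeasurableSpace Ω]
    {P : Measure Ω} {X : ℕ → Ω → ℝ} (hX : IsGaussianProcess X P)
    (h0 : ∀ n, ∫ ω, X n ω ∂P = 0) (hb : ∀ᵐ ω ∂P, ∃ b, ∀ n, |X n ω| ≤ b) :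
    ∃ C : ℝ, 0 < C ∧ ∫⁻ ω, ⨆ n, ENNReal.ofReal (Real.exp (C * X n ω ^ 2)) ∂P < ∞ := by
  have := hX.isProbabilityMeasure
  -- `c > 1/2` makes `c / (1 - c) > 1`, so the series in the Fernique bound converges.
  obtain ⟨c, hc, hc1⟩ : ∃ c : ℝ≥0∞, 2⁻¹ < c ∧ c < 1 := exists_between (by simp)
  obtain ⟨a, ha, hca⟩ := exists_measure_forall_abs_le hb hc1
  set C := Fernique.logRatio c * a⁻¹ ^ 2 with hC
  have hCpos : 0 < C := mul_pos (Fernique.logRatio_pos hc hc1) (by positivity)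
  refine ⟨C, hCpos, ?_⟩
  -- Sup norm of the first `N` variables. The event that all variables are at most `a` lies in `{Y N
  -- ≤ a}`, so the same `a`, `c` and `C` serve every `N`.
  let Y : ℕ → Ω → ℝ := fun N ω ↦ ‖(Finset.range N).restrict (X · ω)‖
  have hYm (N : ℕ) : AEMeasurable (Y N) P :=
    (hX.hasGaussianLaw (Finset.range N)).aemeasurable.norm
  have hmono (ω : Ω) : Monotone fun N ↦ Y N ω := by
    intro N M hNM
    refine (pi_norm_le_iff_of_nonneg (norm_nonneg _)).2 fun i ↦ ?_
    have hi : (i : ℕ) ∈ Finset.range M := by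
      have := Finset.mem_range.1 i.2
      exact Finset.mem_range.2 (by omega)
    exact norm_le_pi_norm ((Finset.range M).restrict (X · ω)) ⟨i, hi⟩
  have hbound (N : ℕ) : ∫⁻ ω, ENNReal.ofReal (Real.exp (C * Y N ω ^ 2)) ∂P ≤
      ENNReal.ofReal (Real.exp (Fernique.logRatio c))
      + ∑' n : ℕ, ENNReal.ofReal
          (Real.exp (-2⁻¹ * Real.log (c / (1 - c)).toReal * 2 ^ n)) := by
    have hG := hX.hasGaussianLaw (Finset.range N)
    have := hG.isGaussian_map
    refine le_trans (le_of_eq ?_) (lintegral_exp_mul_sq_norm_le_of_map_rotation_eq_self (a := a)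
      (hX.map_rotation_eq_self h0 (Finset.range N) _) ?_ hc)
    · rw [lintegral_map' (by fun_prop) hG.aemeasurable]
    · rw [Measure.map_apply_of_aemeasurable hG.aemeasurable
        (measurableSet_le (by fun_prop) (by fun_prop))]
      refine hca.trans (measure_mono fun ω hω ↦ ?_)
      exact (pi_norm_le_iff_of_nonneg ha.le).2 fun i ↦ hω i
  calc ∫⁻ ω, ⨆ n, ENNReal.ofReal (Real.exp (C * X n ω ^ 2)) ∂P
    ≤ ∫⁻ ω, ⨆ N, ENNReal.ofReal (Real.exp (C * Y N ω ^ 2)) ∂P := by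
        refine lintegral_mono fun ω ↦ iSup_le fun n ↦ le_iSup_of_le (n + 1) ?_
        have : |X n ω| ≤ Y (n + 1) ω :=
          norm_le_pi_norm ((Finset.range (n + 1)).restrict (X · ω)) ⟨n, by simp⟩
        rw [← sq_abs]
        gcongr
    _ = ⨆ N, ∫⁻ ω, ENNReal.ofReal (Real.exp (C * Y N ω ^ 2)) ∂P := by
        refine lintegral_iSup' (fun N ↦ by have := hYm N; fun_prop) (ae_of_all _ fun ω N M h ↦ ?_)
        have := hmono ω h
        have h' : 0 ≤ Y N ω := norm_nonneg _
        dsimp only at this ⊢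
        gcongr
    _ ≤ _ := iSup_le hbound
    _ < ∞ := fernique_bound_lt_top hc hc1

/-! ### Moments of suprema of Gaussian fields. -/

lemma isCompact_closedSquare (R : ℝ) : IsCompact (closedSquare R) :=
  isCompact_Icc.prod isCompact_Icc

/-- The supremum of a centred continuous Gaussian random field on a square has a square-exponential
moment. -/
lemma IsCenteredContinuousGRF.exists_exp_sq_bound {Ω : Type*} [MeasurableSpace Ω]
    {P : Measure Ω} {R : ℝ} (hR : 0 < R) {W : ℝ × ℝ → Ω → ℝ}
    (hW : IsCenteredContinuousGRF (closedSquare R) W P) :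
    ∃ C : ℝ, 0 < C ∧ ∃ G : Ω → ℝ≥0∞, AEMeasurable G P ∧ ∫⁻ ω, G ω ∂P < ∞ ∧
      ∀ᵐ ω ∂P, ∀ z ∈ closedSquare R, ENNReal.ofReal (Real.exp (C * W z ω ^ 2)) ≤ G ω := by
  have : Nonempty (closedSquare R) := ⟨⟨(0, 0), by simp [closedSquare, hR.le]⟩⟩
  let d := TopologicalSpace.denseSeq (closedSquare R)
  have hX : IsGaussianProcess (fun (n : ℕ) ↦ W (d n)) P := hW.gaussian.comp_right d
  obtain ⟨C, hC, hfin⟩ := hX.exists_lintegral_iSup_exp_sq_lt_top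
    (fun n ↦ hW.mean_zero _ (d n).2) (by
      filter_upwards [hW.continuous_paths] with ω hω
      obtain ⟨b, hb⟩ := (isCompact_closedSquare R).exists_bound_of_continuousOn hω
      exact ⟨b, fun n ↦ hb _ (d n).2⟩)
  refine ⟨C, hC, _, AEMeasurable.iSup fun n ↦ ?_, hfin, ?_⟩
  · have := hX.aemeasurable n
    fun_prop
  · filter_upwards [hW.continuous_paths] with ω hω z hz
    have hcont : Continuous fun y : closedSquare R ↦
        ENNReal.ofReal (Real.exp (C * W y ω ^ 2)) := by
      have : Continuous fun y : closedSquare R ↦ W y ω := hω.domRestrict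
      exact ENNReal.continuous_ofReal.comp
        (Real.continuous_exp.comp (continuous_const.mul (this.pow 2)))
    have hcl : IsClosed {y : closedSquare R | ENNReal.ofReal (Real.exp (C * W y ω ^ 2)) ≤
        ⨆ n, ENNReal.ofReal (Real.exp (C * W (d n) ω ^ 2))} := isClosed_le hcont continuous_const
    have hsub : Set.range d ⊆ {y : closedSquare R | ENNReal.ofReal (Real.exp (C * W y ω ^ 2)) ≤
        ⨆ n, ENNReal.ofReal (Real.exp (C * W (d n) ω ^ 2))} := by
      rintro _ ⟨n, rfl⟩
      exact le_iSup (fun n ↦ ENNReal.ofReal (Real.exp (C * W (d n) ω ^ 2))) n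
    exact hcl.closure_subset_iff.2 hsub ((TopologicalSpace.denseRange_denseSeq _) ⟨z, hz⟩)

/-- All moments of an exponentially bounded transformation of a centred continuous Gaussian random
field are bounded uniformly in space by an integrable random variable. -/
lemma IsCenteredContinuousGRF.exists_moment_bound {Ω : Type*} [MeasurableSpace Ω]
    {P : Measure Ω} {R : ℝ} (hR : 0 < R) {W : ℝ × ℝ → Ω → ℝ}
    (hW : IsCenteredContinuousGRF (closedSquare R) W P) {Φ : ℝ → ℝ} {b s : ℝ} (hb : 0 ≤ b)
    (hΦ : ∀ x, Φ x ≤ b * Real.exp (s * |x|)) {m : ℝ} (hm : 0 ≤ m) :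
    ∃ H : Ω → ℝ≥0∞, AEMeasurable H P ∧ ∫⁻ ω, H ω ∂P < ∞ ∧
      ∀ᵐ ω ∂P, ∀ z ∈ closedSquare R, ENNReal.ofReal (Φ (W z ω)) ^ m ≤ H ω := by
  obtain ⟨C, hC, G, hGm, hG, hWG⟩ := hW.exists_exp_sq_bound hR
  -- Completing the square: `s m |w| ≤ C w² + (s m)² / (4C)`.
  set B := b ^ m * Real.exp ((s * m) ^ 2 / (4 * C)) with hB
  refine ⟨fun ω ↦ ENNReal.ofReal B * G ω, hGm.const_mul _, ?_, ?_⟩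
  · rw [lintegral_const_mul'' _ hGm]
    exact ENNReal.mul_lt_top ENNReal.ofReal_lt_top hG
  filter_upwards [hWG] with ω hω z hz
  calc ENNReal.ofReal (Φ (W z ω)) ^ m
    ≤ ENNReal.ofReal (b * Real.exp (s * |W z ω|)) ^ m := by
        gcongr
        exact hΦ _
    _ = ENNReal.ofReal (b ^ m * Real.exp (s * |W z ω| * m)) := by
        rw [ENNReal.ofReal_rpow_of_nonneg (by positivity) hm,
          Real.mul_rpow hb (Real.exp_pos _).le, ← Real.exp_mul]
    _ ≤ ENNReal.ofReal (B * Real.exp (C * W z ω ^ 2)) := by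
        rw [hB, mul_assoc, mul_assoc (b ^ m), ← Real.exp_add, ← mul_assoc]
        gcongr
        rw [← sq_abs (W z ω)]
        have : (s * m) ^ 2 / (4 * C) + C * |W z ω| ^ 2 - s * |W z ω| * m =
            (s * m - 2 * C * |W z ω|) ^ 2 / (4 * C) := by
          field_simp
          ring
        have h2 : 0 ≤ (s * m - 2 * C * |W z ω|) ^ 2 / (4 * C) := by positivity
        linarith
    _ = ENNReal.ofReal B * ENNReal.ofReal (Real.exp (C * W z ω ^ 2)) :=
        ENNReal.ofReal_mul (by positivity)
    _ ≤ ENNReal.ofReal B * G ω := by gcongr; exact hω z hz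

/-! ### Exponential growth of the transformations. -/

/-- A function with exponentially bounded derivative is exponentially bounded. -/
lemma le_mul_exp_of_abs_deriv_le {Φ : ℝ → ℝ} (hΦ : Differentiable ℝ Φ) (h0 : 0 ≤ Φ 0) {φ ψ : ℝ}
    (hφ : 0 ≤ φ) (hψ : 0 ≤ ψ) (h : ∀ x, |deriv Φ x| ≤ φ * Real.exp (ψ * |x|)) (x : ℝ) :
    Φ x ≤ (Φ 0 + φ) * Real.exp ((ψ + 1) * |x|) := by
  -- Mean value inequality on `[-|x|, |x|]`; the factor `|x| ≤ exp |x|` then raises the exponent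
  -- from `ψ` to `ψ + 1`.
  have key : ‖Φ x - Φ 0‖ ≤ φ * Real.exp (ψ * |x|) * ‖x - 0‖ := by
    refine Convex.norm_image_sub_le_of_norm_deriv_le (s := Icc (-|x|) |x|)
      (fun y _ ↦ hΦ y) (fun y hy ↦ (h y).trans ?_) (convex_Icc _ _) (by simp)
      ⟨neg_abs_le x, le_abs_self x⟩
    have := abs_le.2 hy
    gcongr
  rw [sub_zero, Real.norm_eq_abs, Real.norm_eq_abs] at key
  have h1 := (le_abs_self _).trans key
  have h2 : |x| ≤ Real.exp |x| := by linarith [Real.add_one_le_exp |x|]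
  have h3 : 1 ≤ Real.exp ((ψ + 1) * |x|) := Real.one_le_exp (by positivity)
  have h4 : Real.exp ((ψ + 1) * |x|) = Real.exp (ψ * |x|) * Real.exp |x| := by
    rw [← Real.exp_add]; ring_nf
  have h5 : φ * Real.exp (ψ * |x|) * |x| ≤ φ * Real.exp ((ψ + 1) * |x|) := by
    rw [h4, ← mul_assoc]
    gcongr
  nlinarith

lemma le_mul_exp_of_lipschitz {Φ : ℝ → ℝ} (h0 : 0 ≤ Φ 0) {C : ℝ} (hC : 0 ≤ C)
    (h : ∀ x y, |Φ x - Φ y| ≤ C * |x - y|) (x : ℝ) :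
    Φ x ≤ (Φ 0 + C) * Real.exp (1 * |x|) := by
  have h1 := (le_abs_self _).trans (h x 0)
  rw [sub_zero] at h1
  have h2 : |x| ≤ Real.exp |x| := by linarith [Real.add_one_le_exp |x|]
  have h3 : 1 ≤ Real.exp |x| := Real.one_le_exp (by positivity)
  rw [one_mul]
  nlinarith

/-! ### Joint measurability and essential suprema. -/

/-- The partial essential supremum of a jointly measurable function is measurable. -/
lemma measurable_essSup_prodMk {α β : Type*} [MeasurableSpace α] [MeasurableSpace β]
    {ν : Measure β} [SFinite ν] {f : α × β → ℝ≥0∞} (hf : Measurable f) :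
    Measurable fun a ↦ essSup (fun b ↦ f (a, b)) ν := by
  refine measurable_of_Iic fun c ↦ ?_
  -- The essential supremum is at most `c` exactly when the section of `{c < f}` is null, and the
  -- measure of a section depends measurably on `a`.
  have : (fun a ↦ essSup (fun b ↦ f (a, b)) ν) ⁻¹' Iic c =
      {a | ν (Prod.mk a ⁻¹' {p | c < f p}) = 0} := by
    ext a
    have h : ν (Prod.mk a ⁻¹' {p | c < f p}) = 0 ↔ ∀ᵐ b ∂ν, f (a, b) ≤ c := by
      simp only [ae_iff, not_le]
      rfl
    simp only [mem_preimage, mem_Iic, mem_ofPred_eq, h]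
    exact ⟨fun hc ↦ (ENNReal.ae_le_essSup _).mono fun b hb ↦ hb.trans hc,
      fun hc ↦ essSup_le_of_ae_le c hc⟩
  rw [this]
  exact measurable_measure_prodMk_left (measurableSet_lt measurable_const hf)
    (measurableSet_singleton 0)

/-- The nearest-point projection onto the closed square. -/
noncomputable def projClosedSquare {R : ℝ} (hR : 0 ≤ R) (z : ℝ × ℝ) : closedSquare R :=
  ⟨(projIcc 0 R hR z.1, projIcc 0 R hR z.2), (projIcc 0 R hR z.1).2, (projIcc 0 R hR z.2).2⟩

lemma continuous_projClosedSquare {R : ℝ} (hR : 0 ≤ R) : Continuous (projClosedSquare hR) := by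
  unfold projClosedSquare
  have h := continuous_projIcc (h := hR)
  fun_prop

lemma coe_projClosedSquare_of_mem {R : ℝ} (hR : 0 ≤ R) {z : ℝ × ℝ} (hz : z ∈ closedSquare R) :
    (projClosedSquare hR z : ℝ × ℝ) = z := by
  refine Prod.ext ?_ ?_
  · simp [projClosedSquare, projIcc_of_mem hR hz.1]
  · simp [projClosedSquare, projIcc_of_mem hR hz.2]

/-- A random field with continuous paths on a square is jointly measurable there. -/
lemma exists_measurable_eq_of_continuousOn {Ω : Type*} [MeasurableSpace Ω] {G : Set Ω}
    (hG : MeasurableSet G) {R : ℝ} (hR : 0 ≤ R) {W : ℝ × ℝ → Ω → ℝ}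
    (hWm : ∀ z ∈ closedSquare R, Measurable (W z))
    (hWc : ∀ ω ∈ G, ContinuousOn (fun z ↦ W z ω) (closedSquare R)) :
    ∃ V : Ω × (ℝ × ℝ) → ℝ, Measurable V ∧
      ∀ ω ∈ G, ∀ z ∈ closedSquare R, W z ω = V (ω, z) := by
  let u : closedSquare R → Ω → ℝ := fun z ↦ G.indicator (W z)
  have hu : Measurable (Function.uncurry u) := by
    refine measurable_uncurry_of_continuous_of_measurable (fun ω ↦ ?_)
      fun z ↦ (hWm z z.2).indicator hG
    by_cases hω : ω ∈ G
    · simp only [u, indicator_of_mem hω]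
      exact (hWc ω hω).domRestrict
    · simp only [u, indicator_of_notMem hω]
      exact continuous_const
  refine ⟨fun p ↦ Function.uncurry u (projClosedSquare hR p.2, p.1), hu.comp
    (((continuous_projClosedSquare hR).measurable.comp measurable_snd).prodMk measurable_fst),
    fun ω hω z hz ↦ ?_⟩
  simp [u, Function.uncurry, indicator_of_mem hω, coe_projClosedSquare_of_mem hR hz]

/-- A monotone function agrees with the infimum over rational points to the right at each
continuity point. -/
lemma Monotone.eq_iInf_rat_of_continuousAt {h : ℝ → ℝ} (hm : Monotone h) {K x : ℝ}
    (hK : ∀ y, h y ≤ K) (hx : ContinuousAt h x) :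
    h x = ⨅ q : ℚ, if x < q then h q else K := by
  -- The default `K` bounds `h` from above, so the indices `q ≤ x` cannot lower the infimum.
  have hlow : ∀ q : ℚ, h x ≤ if x < q then h q else K := by
    intro q
    split_ifs with hq
    · exact hm hq.le
    · exact hK x
  refine le_antisymm (le_ciInf hlow) (le_of_forall_gt_imp_ge_of_dense fun c hc ↦ ?_)
  obtain ⟨ε, hε, hball⟩ := Metric.eventually_nhds_iff.1 (hx.eventually (gt_mem_nhds hc))
  obtain ⟨q, hq1, hq2⟩ := exists_rat_btwn (show x < x + ε by linarith)
  refine (ciInf_le ⟨h x, ?_⟩ q).trans ?_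
  · rintro _ ⟨q, rfl⟩
    exact hlow q
  · rw [if_pos hq1]
    refine (hball ?_).le
    rw [Real.dist_eq, abs_of_pos (by linarith)]
    linarith

/-- A process with non-decreasing paths, cut off at level `K`, agrees at almost every time with a
jointly measurable function. -/
lemma exists_measurable_ae_eq_of_monotoneOn {Ω : Type*} [MeasurableSpace Ω] {G : Set Ω}
    {D : ℝ} (hD : 0 ≤ D) (K : ℝ) {l : ℝ → Ω → ℝ} (hlm : ∀ t ∈ Icc 0 D, Measurable (l t))
    (hl : ∀ ω ∈ G, MonotoneOn (fun t ↦ l t ω) (Icc 0 D)) :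
    ∃ g : Ω × ℝ → ℝ, Measurable g ∧
      ∀ ω ∈ G, ∀ᵐ x, x ∈ Icc 0 D → cutFun K (l x ω) = g (ω, x) := by
  let h : Ω → ℝ → ℝ := fun ω t ↦ min (l (projIcc 0 D hD t) ω) K
  have hh (t : ℝ) : Measurable fun ω ↦ h ω t :=
    (hlm _ (projIcc 0 D hD t).2).min measurable_const
  refine ⟨fun p ↦ ⨅ q : ℚ, if p.2 < q then h p.1 q else K, ?_, fun ω hω ↦ ?_⟩
  · refine Measurable.iInf fun q ↦ Measurable.ite ?_ ((hh q).comp measurable_fst) measurable_const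
    exact measurableSet_lt measurable_snd measurable_const
  · have hmono : Monotone (h ω) := fun s t hst ↦
      min_le_min_right _ (hl ω hω (projIcc 0 D hD s).2 (projIcc 0 D hD t).2
        (monotone_projIcc hD hst))
    filter_upwards [hmono.countable_not_continuousAt.ae_notMem volume] with x hx hxD
    have hx' : ContinuousAt (h ω) x := not_not.1 hx
    have := hmono.eq_iInf_rat_of_continuousAt (K := K)
      (fun y ↦ min_le_right _ _) hx'
    rw [← this]
    simp [h, cutFun, projIcc_of_mem hD hxD]

lemma measurableSet_openSquare (D : ℝ) : MeasurableSet (openSquare D) :=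
  measurableSet_Ioo.prod measurableSet_Ioo

lemma openSquare_subset_closedSquare (D : ℝ) : openSquare D ⊆ closedSquare D :=
  prod_mono Ioo_subset_Icc_self Ioo_subset_Icc_self

/-- Keeps the argument of `W₂` inside the square where its paths are continuous and its supremum is
controlled. -/
lemma cutFun_mem_Icc {D K : ℝ} (hK : 0 ≤ K) {l : ℝ → ℝ} (h0 : l 0 = 0)
    (hl : MonotoneOn l (Icc 0 D)) {x : ℝ} (hx : x ∈ Ioo 0 D) : cutFun K (l x) ∈ Icc 0 K := by
  refine ⟨le_min ?_ hK, min_le_right _ _⟩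
  rw [← h0]
  exact hl ⟨le_rfl, (hx.1.trans hx.2).le⟩ (Ioo_subset_Icc_self hx) hx.1.le

/-- The coefficient agrees at almost every point with a jointly measurable function. -/
lemma exists_measurable_ae_eq_coeffK {Ω : Type*} [MeasurableSpace Ω] {G : Set Ω}
    (hG : MeasurableSet G) {D K : ℝ} (hD : 0 ≤ D) (hK : 0 ≤ K) {abar : ℝ × ℝ → ℝ}
    (habar : ContinuousOn abar (openSquare D)) {Φ₁ Φ₂ : ℝ → ℝ} (hΦ₁ : Measurable Φ₁)
    (hΦ₂ : Measurable Φ₂) {W₁ W₂ : ℝ × ℝ → Ω → ℝ} {l₁ l₂ : ℝ → Ω → ℝ}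
    (hW₁m : ∀ z ∈ closedSquare D, Measurable (W₁ z))
    (hW₁c : ∀ ω ∈ G, ContinuousOn (fun z ↦ W₁ z ω) (closedSquare D))
    (hW₂m : ∀ z ∈ closedSquare K, Measurable (W₂ z))
    (hW₂c : ∀ ω ∈ G, ContinuousOn (fun z ↦ W₂ z ω) (closedSquare K))
    (hl₁m : ∀ t ∈ Icc 0 D, Measurable (l₁ t))
    (hl₁ : ∀ ω ∈ G, MonotoneOn (fun t ↦ l₁ t ω) (Icc 0 D)) (hl₁0 : ∀ ω ∈ G, l₁ 0 ω = 0)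
    (hl₂m : ∀ t ∈ Icc 0 D, Measurable (l₂ t))
    (hl₂ : ∀ ω ∈ G, MonotoneOn (fun t ↦ l₂ t ω) (Icc 0 D)) (hl₂0 : ∀ ω ∈ G, l₂ 0 ω = 0) :
    ∃ f : Ω × (ℝ × ℝ) → ℝ, Measurable f ∧ ∀ ω ∈ G, ∀ᵐ z ∂(volume.restrict (openSquare D)),
      coeffK abar Φ₁ Φ₂ W₁ W₂ l₁ l₂ K ω z = f (ω, z) := by
  obtain ⟨V₁, hV₁, hWV₁⟩ := exists_measurable_eq_of_continuousOn hG hD hW₁m hW₁c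
  obtain ⟨V₂, hV₂, hWV₂⟩ := exists_measurable_eq_of_continuousOn hG hK hW₂m hW₂c
  obtain ⟨g₁, hg₁, hlg₁⟩ := exists_measurable_ae_eq_of_monotoneOn hD K hl₁m hl₁
  obtain ⟨g₂, hg₂, hlg₂⟩ := exists_measurable_ae_eq_of_monotoneOn hD K hl₂m hl₂
  have habarm : Measurable ((openSquare D).indicator abar) := by
    classical
    have := habar.measurable_piecewise (g := fun _ ↦ 0) continuousOn_const
      (measurableSet_openSquare D)
    rwa [show (fun _ ↦ 0 : ℝ × ℝ → ℝ) = 0 from rfl, piecewise_eq_indicator] at this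
  refine ⟨fun p ↦ (openSquare D).indicator abar p.2 + Φ₁ (V₁ p) +
    Φ₂ (V₂ (p.1, (g₁ (p.1, p.2.1), g₂ (p.1, p.2.2)))), by fun_prop, fun ω hω ↦ ?_⟩
  have h₁ : ∀ᵐ z : ℝ × ℝ, z.1 ∈ Icc 0 D → cutFun K (l₁ z.1 ω) = g₁ (ω, z.1) :=
    Measure.quasiMeasurePreserving_fst.ae (hlg₁ ω hω)
  have h₂ : ∀ᵐ z : ℝ × ℝ, z.2 ∈ Icc 0 D → cutFun K (l₂ z.2 ω) = g₂ (ω, z.2) :=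
    Measure.quasiMeasurePreserving_snd.ae (hlg₂ ω hω)
  filter_upwards [ae_restrict_of_ae h₁, ae_restrict_of_ae h₂,
    ae_restrict_mem (measurableSet_openSquare D)] with z hz₁ hz₂ hz
  have hz' := openSquare_subset_closedSquare D hz
  rw [coeffK, hWV₁ ω hω z hz', hWV₂ ω hω _ ⟨cutFun_mem_Icc hK (hl₁0 ω hω) (hl₁ ω hω) hz.1,
    cutFun_mem_Icc hK (hl₂0 ω hω) (hl₂ ω hω) hz.2⟩, hz₁ hz'.1, hz₂ hz'.2, indicator_of_mem hz]

/-- Spatial essential suprema of measurable functions of the coefficient are random variables. -/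
lemma aemeasurable_spatialEssSup_coeffK {Ω : Type*} [MeasurableSpace Ω] {P : Measure Ω}
    {D K : ℝ} (hD : 0 < D) (hK : 0 < K) {abar : ℝ × ℝ → ℝ}
    (habar : ContinuousOn abar (openSquare D)) {Φ₁ Φ₂ : ℝ → ℝ} (hΦ₁ : Measurable Φ₁)
    (hΦ₂ : Measurable Φ₂) {W₁ W₂ : ℝ × ℝ → Ω → ℝ} {l₁ l₂ : ℝ → Ω → ℝ}
    (hW₁ : IsCenteredContinuousGRF (closedSquare D) W₁ P)
    (hW₂ : IsCenteredContinuousGRF (closedSquare K) W₂ P)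
    (hl₁ : IsSubordinatorOn D l₁ P) (hl₂ : IsSubordinatorOn D l₂ P)
    {T : ℝ → ℝ} (hT : Measurable T) :
    AEMeasurable (fun ω ↦ spatialEssSup D
      (fun z ↦ T (coeffK abar Φ₁ Φ₂ W₁ W₂ l₁ l₂ K ω z))) P := by
  let G : Set Ω := {ω | ContinuousOn (fun z ↦ W₁ z ω) (closedSquare D) ∧
    ContinuousOn (fun z ↦ W₂ z ω) (closedSquare K) ∧
    (MonotoneOn (fun t ↦ l₁ t ω) (Icc 0 D) ∧ l₁ 0 ω = 0) ∧
    (MonotoneOn (fun t ↦ l₂ t ω) (Icc 0 D) ∧ l₂ 0 ω = 0)}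
  have hGae : ∀ᵐ ω ∂P, ω ∈ G := by
    filter_upwards [hW₁.continuous_paths, hW₂.continuous_paths, hl₁.monotone_paths,
      hl₂.monotone_paths, hl₁.start_zero, hl₂.start_zero] with ω h1 h2 h3 h4 h5 h6
    exact ⟨h1, h2, ⟨h3, h5⟩, h4, h6⟩
  have hG : NullMeasurableSet G P := by
    have : NullMeasurableSet Gᶜ P := NullMeasurableSet.of_null hGae
    simpa using this.compl
  have hc {f : Ω → ℝ} (hf : AEMeasurable f P) :
      @Measurable (NullMeasurableSpace Ω P) ℝ _ _ f := hf.nullMeasurable.measurable'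
  -- On the completed σ-algebra the good set `G` and the a.e. measurable variables become
  -- measurable.
  obtain ⟨f, hf, hfG⟩ := exists_measurable_ae_eq_coeffK (Ω := NullMeasurableSpace Ω P) (G := G)
    hG hD.le hK.le habar hΦ₁ hΦ₂ (W₁ := W₁) (W₂ := W₂) (l₁ := l₁) (l₂ := l₂)
    (fun z hz ↦ hc (hW₁.gaussian.aemeasurable ⟨z, hz⟩)) (fun ω hω ↦ hω.1)
    (fun z hz ↦ hc (hW₂.gaussian.aemeasurable ⟨z, hz⟩)) (fun ω hω ↦ hω.2.1)
    (fun t ht ↦ hc (hl₁.aemeasurable t ht)) (fun ω hω ↦ hω.2.2.1.1) (fun ω hω ↦ hω.2.2.1.2)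
    (fun t ht ↦ hc (hl₂.aemeasurable t ht)) (fun ω hω ↦ hω.2.2.2.1) (fun ω hω ↦ hω.2.2.2.2)
  have hmeas := measurable_essSup_prodMk (ν := volume.restrict (openSquare D))
    (f := fun p : NullMeasurableSpace Ω P × (ℝ × ℝ) ↦ ENNReal.ofReal (T (f p)))
    (hT.comp hf).ennreal_ofReal
  have hnull : NullMeasurable (fun ω : Ω ↦
      essSup (fun z ↦ ENNReal.ofReal (T (f (ω, z)))) (volume.restrict (openSquare D))) P :=
    fun s hs ↦ hmeas hs
  refine hnull.aemeasurable.congr ?_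
  filter_upwards [hGae] with ω hω
  refine essSup_congr_ae ?_
  filter_upwards [hfG ω hω] with z hz
  rw [← hz]
  rfl

/-! ### Moments of the coefficient and the truncation error. -/

/-- All powers of the coefficient are bounded uniformly in space by an integrable random
variable. -/
lemma exists_moment_bound_coeffK {Ω : Type*} [MeasurableSpace Ω] {P : Measure Ω}
    [IsProbabilityMeasure P] {D K : ℝ} (hD : 0 < D) (hK : 0 < K) {abar : ℝ × ℝ → ℝ} {aplus : ℝ}
    (habar : ∀ z ∈ openSquare D, abar z ≤ aplus) {Φ₁ Φ₂ : ℝ → ℝ} {b₁ b₂ s₁ s₂ : ℝ} (hb₁ : 0 ≤ b₁)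
    (hb₂ : 0 ≤ b₂) (hΦ₁ : ∀ x, Φ₁ x ≤ b₁ * Real.exp (s₁ * |x|))
    (hΦ₂ : ∀ x, Φ₂ x ≤ b₂ * Real.exp (s₂ * |x|))
    {W₁ W₂ : ℝ × ℝ → Ω → ℝ} {l₁ l₂ : ℝ → Ω → ℝ}
    (hW₁ : IsCenteredContinuousGRF (closedSquare D) W₁ P)
    (hW₂ : IsCenteredContinuousGRF (closedSquare K) W₂ P)
    (hl₁ : IsSubordinatorOn D l₁ P) (hl₂ : IsSubordinatorOn D l₂ P) {m : ℝ} (hm : 1 ≤ m) :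
    ∃ H : Ω → ℝ≥0∞, ∫⁻ ω, H ω ∂P < ∞ ∧ ∀ᵐ ω ∂P, ∀ z ∈ openSquare D,
      ENNReal.ofReal (coeffK abar Φ₁ Φ₂ W₁ W₂ l₁ l₂ K ω z) ^ m ≤ H ω := by
  have hm0 : 0 ≤ m := by linarith
  obtain ⟨H₁, hH₁m, hH₁, hWH₁⟩ := hW₁.exists_moment_bound hD hb₁ hΦ₁ hm0
  obtain ⟨H₂, hH₂m, hH₂, hWH₂⟩ := hW₂.exists_moment_bound hK hb₂ hΦ₂ hm0
  -- The constant in `(x + y)^m ≤ 2^(m-1) (x^m + y^m)`, used twice for the three summands.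
  set c : ℝ≥0∞ := 2 ^ (m - 1)
  have hc : c < ∞ := ENNReal.rpow_lt_top_of_nonneg (by linarith) (by simp)
  refine ⟨fun ω ↦ c * (c * (ENNReal.ofReal aplus ^ m + H₁ ω) + H₂ ω), ?_, ?_⟩
  · rw [lintegral_const_mul'' _ (by fun_prop), lintegral_add_left' (by fun_prop),
      lintegral_const_mul'' _ (by fun_prop), lintegral_add_left' (by fun_prop)]
    have : ENNReal.ofReal aplus ^ m < ∞ := ENNReal.rpow_lt_top_of_nonneg hm0 (by simp)
    simp only [lintegral_const, measure_univ, mul_one]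
    finiteness
  · filter_upwards [hWH₁, hWH₂, hl₁.monotone_paths, hl₂.monotone_paths, hl₁.start_zero,
      hl₂.start_zero] with ω h1 h2 h3 h4 h5 h6 z hz
    have hz₂ : (cutFun K (l₁ z.1 ω), cutFun K (l₂ z.2 ω)) ∈ closedSquare K :=
      ⟨cutFun_mem_Icc hK.le h5 h3 hz.1, cutFun_mem_Icc hK.le h6 h4 hz.2⟩
    refine (ENNReal.rpow_le_rpow ((ENNReal.ofReal_add_le).trans
      (add_le_add_left ENNReal.ofReal_add_le _)) hm0).trans ?_
    refine (ENNReal.rpow_add_le_mul_rpow_add_rpow _ _ hm).trans ?_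
    gcongr
    · refine (ENNReal.rpow_add_le_mul_rpow_add_rpow _ _ hm).trans ?_
      gcongr
      · exact habar z hz
      · exact h1 z (openSquare_subset_closedSquare D hz)
    · exact h2 _ hz₂

lemma spatialEssSup_rpow_le {D : ℝ} {f : ℝ × ℝ → ℝ} {m : ℝ} (hm : 0 < m) {c : ℝ≥0∞}
    (h : ∀ z ∈ openSquare D, ENNReal.ofReal (f z) ^ m ≤ c) : spatialEssSup D f ^ m ≤ c := by
  rw [← ENNReal.le_rpow_inv_iff hm]
  refine essSup_le_of_ae_le _ ?_
  filter_upwards [ae_restrict_mem (measurableSet_openSquare D)] with z hz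
  rw [ENNReal.le_rpow_inv_iff hm]
  exact h z hz

lemma abs_sub_cutFun_le {a A : ℝ} (ha : 0 ≤ a) (hA : 0 < A) :
    |a - cutFun A a| ≤ a ^ 2 / A := by
  rw [cutFun, le_div_iff₀ hA]
  rcases le_total a A with h | h
  · rw [min_eq_left h, sub_self, abs_zero, zero_mul]
    positivity
  · rw [min_eq_right h, abs_of_nonneg (by linarith)]
    nlinarith

theorem theorem5p4 {Ω : Type*} [MeasurableSpace Ω] (P : Measure Ω) [IsProbabilityMeasure P]
    (D K : ℝ) (hD : 0 < D) (hK : 0 < K)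
    -- the deterministic part of the coefficient
    (abar : ℝ × ℝ → ℝ) (aminus aplus : ℝ) (h_aminus : 0 < aminus) (h_aplus : 0 < aplus)
    (h_abar_cont : ContinuousOn abar (openSquare D))
    (h_abar_bdd : ∀ z ∈ openSquare D, aminus ≤ abar z ∧ abar z ≤ aplus)
    -- the transformations of the Gaussian fields
    (Φ₁ Φ₂ : ℝ → ℝ) (hΦ₁_nonneg : ∀ x, 0 ≤ Φ₁ x) (hΦ₂_nonneg : ∀ x, 0 ≤ Φ₂ x)
    (φ ψ Clip : ℝ) (hφ : 0 < φ) (hψ : 0 < ψ) (hClip : 0 < Clip)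
    (hΦ₁_smooth : ContDiff ℝ 1 Φ₁)
    (hΦ₁_deriv : ∀ x, |deriv Φ₁ x| ≤ φ * Real.exp (ψ * |x|))
    (hΦ₂_lip : ∀ x y, |Φ₂ x - Φ₂ y| ≤ Clip * |x - y|)
    -- the Gaussian random fields and the subordinators
    (W₁ W₂ : ℝ × ℝ → Ω → ℝ) (l₁ l₂ : ℝ → Ω → ℝ)
    (hW₁ : IsCenteredContinuousGRF (closedSquare D) W₁ P)
    (hW₂ : IsCenteredContinuousGRF (closedSquare K) W₂ P)
    (hl₁ : IsSubordinatorOn D l₁ P) (hl₂ : IsSubordinatorOn D l₂ P)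
    (h_indep_W : IndepFun (pathOn (closedSquare D) W₁) (pathOn (closedSquare K) W₂) P)
    (h_indep_l₁W₁ : IndepFun (pathOn (Icc 0 D) l₁) (pathOn (closedSquare D) W₁) P)
    (h_indep_l₁W₂ : IndepFun (pathOn (Icc 0 D) l₁) (pathOn (closedSquare K) W₂) P)
    (h_indep_l₂W₁ : IndepFun (pathOn (Icc 0 D) l₂) (pathOn (closedSquare D) W₁) P)
    (h_indep_l₂W₂ : IndepFun (pathOn (Icc 0 D) l₂) (pathOn (closedSquare K) W₂) P) :
    -- the essential suprema are random variables
    AEMeasurable (fun ω => spatialEssSup D (coeffK abar Φ₁ Φ₂ W₁ W₂ l₁ l₂ K ω)) P ∧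
    (∀ A : ℝ, 0 < A → AEMeasurable (fun ω => spatialEssSup D (fun z =>
      |coeffK abar Φ₁ Φ₂ W₁ W₂ l₁ l₂ K ω z - coeffKA abar Φ₁ Φ₂ W₁ W₂ l₁ l₂ K A ω z|)) P) ∧
    ∀ n : ℝ, 1 < n →
      (∫⁻ ω, spatialEssSup D (coeffK abar Φ₁ Φ₂ W₁ W₂ l₁ l₂ K ω) ^ n ∂P) ^ (1 / n) < ∞ ∧
      ∀ δ : ℝ, 0 < δ → ∃ A : ℝ, 0 < A ∧
        (∫⁻ ω, spatialEssSup D (fun z =>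
          |coeffK abar Φ₁ Φ₂ W₁ W₂ l₁ l₂ K ω z -
            coeffKA abar Φ₁ Φ₂ W₁ W₂ l₁ l₂ K A ω z|) ^ n ∂P) ^ (1 / n) < ENNReal.ofReal δ := by
  have hΦ₁_exp := le_mul_exp_of_abs_deriv_le (hΦ₁_smooth.differentiable one_ne_zero)
    (hΦ₁_nonneg 0) hφ.le hψ.le hΦ₁_deriv
  have hΦ₂_exp := le_mul_exp_of_lipschitz (hΦ₂_nonneg 0) hClip.le hΦ₂_lip
  have hΦ₂_cont : Continuous Φ₂ :=
    (LipschitzWith.of_dist_le_mul (K := ⟨Clip, hClip.le⟩) hΦ₂_lip).continuous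
  have hmeas {T : ℝ → ℝ} (hT : Measurable T) :=
    aemeasurable_spatialEssSup_coeffK hD hK h_abar_cont hΦ₁_smooth.continuous.measurable
      hΦ₂_cont.measurable hW₁ hW₂ hl₁ hl₂ hT
  have hbound {m : ℝ} (hm : 1 ≤ m) :=
    exists_moment_bound_coeffK hD hK (fun z hz ↦ (h_abar_bdd z hz).2)
      (add_nonneg (hΦ₁_nonneg 0) hφ.le) (add_nonneg (hΦ₂_nonneg 0) hClip.le) hΦ₁_exp hΦ₂_exp
      hW₁ hW₂ hl₁ hl₂ hm
  refine ⟨hmeas (T := fun a ↦ a) measurable_id, fun A _ ↦ ?_, fun n hn ↦ ?_⟩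
  · exact hmeas (T := fun a ↦ |a - cutFun A a|) (by unfold cutFun; fun_prop)
  have hn0 : 0 < n := by linarith
  refine ⟨?_, fun δ hδ ↦ ?_⟩
  · obtain ⟨H, hH, hle⟩ := hbound hn.le
    refine ENNReal.rpow_lt_top_of_nonneg (by positivity) (ne_of_lt (lt_of_le_of_lt ?_ hH))
    refine lintegral_mono_ae ?_
    filter_upwards [hle] with ω hω
    exact spatialEssSup_rpow_le hn0 hω
  -- Order `2n`, since the error is bounded by `a² / A`.
  · obtain ⟨H, hH, hle⟩ := hbound (m := 2 * n) (by linarith)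
    set J : ℝ := (∫⁻ ω, H ω ∂P).toReal with hJ
    have hHJ : ∫⁻ ω, H ω ∂P = ENNReal.ofReal J := (ENNReal.ofReal_toReal hH.ne).symm
    have hJ0 : 0 ≤ J := ENNReal.toReal_nonneg
    -- Chosen so that `J^(1/n) / A < δ`; the `+ 1` gives strictness, and `A > 0` even if `J = 0`.
    set A : ℝ := (J ^ (1 / n) + 1) / δ with hA
    have hA0 : 0 < A := by positivity
    refine ⟨A, hA0, ?_⟩
    have hInt : ∫⁻ ω, spatialEssSup D (fun z =>
          |coeffK abar Φ₁ Φ₂ W₁ W₂ l₁ l₂ K ω z -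
            coeffKA abar Φ₁ Φ₂ W₁ W₂ l₁ l₂ K A ω z|) ^ n ∂P ≤
        ENNReal.ofReal (A⁻¹ ^ n) * ENNReal.ofReal J := by
      rw [← hHJ, ← lintegral_const_mul' _ _ ENNReal.ofReal_ne_top]
      refine lintegral_mono_ae ?_
      filter_upwards [hle] with ω hω
      refine spatialEssSup_rpow_le hn0 fun z hz ↦ ?_
      have ha : 0 ≤ coeffK abar Φ₁ Φ₂ W₁ W₂ l₁ l₂ K ω z :=
        add_nonneg (add_nonneg (h_aminus.le.trans (h_abar_bdd z hz).1) (hΦ₁_nonneg _))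
          (hΦ₂_nonneg _)
      refine le_trans ?_ (mul_le_mul_right (hω z hz) _)
      rw [ENNReal.ofReal_rpow_of_nonneg (abs_nonneg _) hn0.le,
        ENNReal.ofReal_rpow_of_nonneg ha (by positivity), ← ENNReal.ofReal_mul (by positivity),
        Real.rpow_mul ha, Real.rpow_two, ← Real.mul_rpow (by positivity) (by positivity)]
      gcongr
      exact (abs_sub_cutFun_le ha hA0).trans_eq (by ring)
    calc _ ≤ (ENNReal.ofReal (A⁻¹ ^ n) * ENNReal.ofReal J) ^ (1 / n) := by gcongr
      _ = ENNReal.ofReal (J ^ (1 / n) / A) := by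
        rw [← ENNReal.ofReal_mul (by positivity),
          ENNReal.ofReal_rpow_of_nonneg (by positivity) (by positivity),
          Real.mul_rpow (by positivity) hJ0, ← Real.rpow_mul (by positivity),
          mul_one_div_cancel hn0.ne', Real.rpow_one]
        congr 1
        ring
      _ < ENNReal.ofReal δ := by
        rw [ENNReal.ofReal_lt_ofReal_iff hδ, div_lt_iff₀ hA0, hA, mul_div_cancel₀ _ hδ.ne']
        linarith
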